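/- Let $p$ be a prime, let $k$ be a perfect field of characteristic $p$, and let $G$ be an étale group scheme over $k$. For a ring $B$ write $B((t))=B[[t]][t^{-1}]$. Let $\Delta_G$ be the category fibered in groupoids over affine $k$-schemes whose objects over $\operatorname{Spec} B$ are the $G$-torsors over $\operatorname{Spec} B((t))$ (with $G$-equivariant morphisms, and pullback along $B\to B'$ given by base change along $B((t))\to B'((t))$). Via $\mathrm{Aff}/k\to\mathrm{Aff}/\mathbb F_p$ regard $\Delta_G$ as a category fibered in groupoids over affine $\mathbb F_p$-schemes. For a category $\mathcal X$ fibered in groupoids over affine $\mathbb F_p$-schemes, its Frobenius is the functor $F_{\mathcal X}\colon\mathcal X\to\mathcal X$ sending $\xi\in\mathcal X(B)$ to $F_B^*\xi\in\mathcal X(B)$, where $F_B\colon B\to B$, $b\mapsto b^p$, is the absolute Frobenius; $\mathcal X$ is called perfect if $F_{\mathcal X}$ is an equivalence. Then $\Delta_G$ is perfect, i.e. the Frobenius $F_{\Delta_G}\colon\Delta_G\to\Delta_G$ is an equivalence. -/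

import Mathlib

open CategoryTheory AlgebraicGeometry Limits MonoidalCategory CartesianMonoidalCategory
open Opposite

universe v u w

noncomputable section

namespace FormalTorsor

/-! ### Fibered categories over affine schemes in characteristic `p` and their Frobenius -/

section Frobenius

/-- A category fibered in groupoids: a fibered category all of whose fibers are groupoids, i.e.
every morphism lying over an identity is an isomorphism. -/
class IsFiberedInGroupoids {𝒮 : Type*} {𝒳 : Type*} [Category 𝒮] [Category 𝒳] (π : 𝒳 ⥤ 𝒮) : Prop
    extends π.IsFibered where
  isIso_of_fiber : ∀ {S : 𝒮} {a b : 𝒳} (φ : a ⟶ b), π.IsHomLift (𝟙 S) φ → IsIso φ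

variable (p : ℕ) [Fact p.Prime]

/-- The category `Aff/𝔽_p` of affine schemes over `𝔽_p`. -/
abbrev AffFp : Type (u + 1) := (CommAlgCat.{u} (ZMod p))ᵒᵖ

variable {p}

/-- The absolute Frobenius of an affine `𝔽_p`-scheme. -/
def absFrob (S : AffFp.{u} p) : S ⟶ S :=
  (CommAlgCat.ofHom (FiniteField.frobeniusAlgHom (ZMod p) S.unop)).op

lemma absFrob_apply (S : AffFp.{u} p) (x : S.unop) : (absFrob S).unop.hom x = x ^ p := by
  change x ^ Fintype.card (ZMod p) = x ^ p
  rw [ZMod.card]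

lemma absFrob_naturality {S T : AffFp.{u} p} (f : S ⟶ T) :
    absFrob S ≫ f = f ≫ absFrob T := by
  apply Quiver.Hom.unop_inj
  ext x
  change (absFrob S).unop.hom (f.unop.hom x) = f.unop.hom ((absFrob T).unop.hom x)
  rw [absFrob_apply, absFrob_apply, map_pow]

variable {𝒳 : Type v} [Category.{w} 𝒳] (π : 𝒳 ⥤ AffFp.{u} p) [IsFiberedInGroupoids π]

/-- The pullback `F_S^* ξ` of an object `ξ` of `𝒳(S)` along the absolute Frobenius `F_S`. -/
def frobPullback (ξ : 𝒳) : 𝒳 :=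
  Functor.IsPreFibered.pullbackObj (p := π) (a := ξ) rfl (absFrob (π.obj ξ))

/-- The Cartesian arrow `F_S^* ξ ⟶ ξ` over the absolute Frobenius `F_S`. -/
def frobPullbackMap (ξ : 𝒳) : frobPullback π ξ ⟶ ξ :=
  Functor.IsPreFibered.pullbackMap (p := π) (a := ξ) rfl (absFrob (π.obj ξ))

instance (ξ : 𝒳) : π.IsCartesian (absFrob (π.obj ξ)) (frobPullbackMap π ξ) :=
  inferInstanceAs (π.IsCartesian _ (Functor.IsPreFibered.pullbackMap (p := π) (a := ξ) rfl _))

/-- `F_S^*` on a morphism `φ : ξ ⟶ η` of `𝒳`: the unique arrow over `π(φ)` compatible with the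
Cartesian arrows `F^* ξ ⟶ ξ` and `F^* η ⟶ η`. -/
def frobMap {ξ η : 𝒳} (φ : ξ ⟶ η) : frobPullback π ξ ⟶ frobPullback π η :=
  Functor.IsStronglyCartesian.map π (absFrob (π.obj η)) (frobPullbackMap π η)
    (absFrob_naturality (π.map φ)) (frobPullbackMap π ξ ≫ φ)

instance {ξ η : 𝒳} (φ : ξ ⟶ η) : π.IsHomLift (π.map φ) (frobMap π φ) :=
  inferInstanceAs (π.IsHomLift (π.map φ) (Functor.IsStronglyCartesian.map π _ _ _ _))

lemma frobMap_fac {ξ η : 𝒳} (φ : ξ ⟶ η) :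
    frobMap π φ ≫ frobPullbackMap π η = frobPullbackMap π ξ ≫ φ :=
  Functor.IsStronglyCartesian.fac π (absFrob (π.obj η)) (frobPullbackMap π η)
    (absFrob_naturality (π.map φ)) (frobPullbackMap π ξ ≫ φ)

lemma frobMap_uniq {ξ η : 𝒳} (φ : ξ ⟶ η) (ψ : frobPullback π ξ ⟶ frobPullback π η)
    [π.IsHomLift (π.map φ) ψ] (h : ψ ≫ frobPullbackMap π η = frobPullbackMap π ξ ≫ φ) :
    ψ = frobMap π φ :=
  Functor.IsStronglyCartesian.map_uniq π (absFrob (π.obj η)) (frobPullbackMap π η)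
    (absFrob_naturality (π.map φ)) (frobPullbackMap π ξ ≫ φ) ψ h

/-- The Frobenius `F_𝒳 : 𝒳 ⥤ 𝒳` of a category fibered in groupoids over `Aff/𝔽_p`; it maps
`ξ ∈ 𝒳(S)` to `F_S^* ξ ∈ 𝒳(S)`. -/
def frobenius : 𝒳 ⥤ 𝒳 where
  obj ξ := frobPullback π ξ
  map φ := frobMap π φ
  map_id ξ := by
    have : π.IsHomLift (π.map (𝟙 ξ)) (𝟙 (frobPullback π ξ)) := by
      rw [π.map_id]
      exact IsHomLift.id (Functor.IsPreFibered.pullbackObj_proj _ _)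
    exact (frobMap_uniq π (𝟙 ξ) (𝟙 _) (by simp)).symm
  map_comp {a b c} φ ψ := by
    have : π.IsHomLift (π.map (φ ≫ ψ)) (frobMap π φ ≫ frobMap π ψ) := by
      rw [π.map_comp]; infer_instance
    refine (frobMap_uniq π (φ ≫ ψ) (frobMap π φ ≫ frobMap π ψ) ?_).symm
    rw [Category.assoc, frobMap_fac, ← Category.assoc, frobMap_fac, Category.assoc]

/-- The Frobenius is a functor over `Aff/𝔽_p`. -/
lemma frobenius_comp : frobenius π ⋙ π = π :=
  CategoryTheory.Functor.ext
    (fun _ => Functor.IsPreFibered.pullbackObj_proj (p := π) rfl _)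
    (fun _ _ φ => IsHomLift.fac' π (π.map φ) (frobMap π φ))

/-- A category fibered in groupoids `𝒳` over `Aff/𝔽_p` is perfect if its Frobenius is an
equivalence. (The Frobenius lies over the identity of `Aff/𝔽_p`, and such a functor is an
equivalence of fibered categories if and only if it is an equivalence of categories.) -/
def IsPerfect : Prop := (frobenius π).IsEquivalence

end Frobenius

/-! ### Torsors under a group scheme -/

section Torsors

variable {S : Scheme.{u}} (G : Over S) [GrpObj G]

/-- A (right) `G`-torsor over an `S`-scheme `X`, for a group scheme `G` over `S`: an `X`-scheme
`P ⟶ X` with a right action of `G` over `X` such that `P ⟶ X` is an fppf covering and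
`(q, g) ↦ (q, q g)` is an isomorphism `P ×_S G ≅ P ×_X P`; equivalently, `P` is fppf locally on `X`
isomorphic to `X ×_S G` with its action by right translation. -/
structure Torsor (X : Over S) where
  /-- The total space. -/
  P : Over S
  /-- The structure morphism. -/
  proj : P ⟶ X
  /-- The action. -/
  act : P ⊗ G ⟶ P
  act_one : P ◁ MonObj.one ≫ act = (ρ_ P).hom
  act_mul : (act ▷ G) ≫ act = (α_ P G G).hom ≫ P ◁ MonObj.mul ≫ act
  flat : Flat proj.left
  locallyOfFinitePresentation : LocallyOfFinitePresentation proj.left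
  surjective : Surjective proj.left
  isPullback : IsPullback (fst P G) act proj proj

variable {G}

attribute [instance] Torsor.flat Torsor.locallyOfFinitePresentation Torsor.surjective

namespace Torsor

lemma act_proj {X : Over S} (T : Torsor G X) : T.act ≫ T.proj = fst _ _ ≫ T.proj :=
  T.isPullback.w.symm

/-- The base change `X' ×_X P` of a torsor. -/
def baseChange {X X' : Over S} (T : Torsor G X) (f : X' ⟶ X) : Torsor G X' where
  P := pullback T.proj f
  proj := pullback.snd T.proj f
  act := pullback.lift ((pullback.fst T.proj f ▷ G) ≫ T.act) (fst _ _ ≫ pullback.snd T.proj f)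
    (by rw [Category.assoc, act_proj, whiskerRight_fst_assoc, pullback.condition, Category.assoc])
  act_one := by
    apply pullback.hom_ext
    · rw [Category.assoc, pullback.lift_fst, whisker_exchange_assoc, T.act_one,
        rightUnitor_naturality]
    · rw [Category.assoc, pullback.lift_snd, whiskerLeft_fst_assoc, rightUnitor_hom]
  act_mul := by
    apply pullback.hom_ext
    · simp only [Category.assoc, pullback.lift_fst]
      rw [← comp_whiskerRight_assoc, pullback.lift_fst, comp_whiskerRight_assoc, T.act_mul,
        whisker_exchange_assoc]
      simp
    · simp only [Category.assoc, pullback.lift_snd]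
      rw [whiskerRight_fst_assoc, pullback.lift_snd, whiskerLeft_fst_assoc,
        associator_hom_fst_assoc]
  flat := by
    have h := (IsPullback.of_hasPullback T.proj f).map (Over.forget S)
    exact MorphismProperty.of_isPullback (P := @Flat) h T.flat
  locallyOfFinitePresentation := by
    have h := (IsPullback.of_hasPullback T.proj f).map (Over.forget S)
    exact MorphismProperty.of_isPullback (P := @LocallyOfFinitePresentation) h
      T.locallyOfFinitePresentation
  surjective := by
    have h := (IsPullback.of_hasPullback T.proj f).map (Over.forget S)
    exact MorphismProperty.of_isPullback (P := @Surjective) h T.surjective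
  isPullback := by
    refine ⟨⟨by rw [pullback.lift_snd]⟩, ⟨PullbackCone.IsLimit.mk _
      (fun s => lift s.fst (T.isPullback.lift (s.fst ≫ pullback.fst _ _)
        (s.snd ≫ pullback.fst _ _) ?_ ≫ snd _ _)) ?_ ?_ ?_⟩⟩
    · rw [Category.assoc, Category.assoc, pullback.condition, reassoc_of% s.condition]
    · intro s
      simp
    · intro s
      have key : ∀ h, lift s.fst (T.isPullback.lift (s.fst ≫ pullback.fst T.proj f)
          (s.snd ≫ pullback.fst T.proj f) h ≫ snd _ _) ≫ (pullback.fst T.proj f ▷ G) =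
          T.isPullback.lift (s.fst ≫ pullback.fst T.proj f) (s.snd ≫ pullback.fst T.proj f) h := by
        intro h
        apply CartesianMonoidalCategory.hom_ext <;> simp
      apply pullback.hom_ext
      · rw [Category.assoc, pullback.lift_fst, reassoc_of% key, T.isPullback.lift_snd]
      · rw [Category.assoc, pullback.lift_snd, lift_fst_assoc, s.condition]
    · intro s m h₁ h₂
      apply CartesianMonoidalCategory.hom_ext
      · rw [h₁, lift_fst]
      · have : m ≫ (pullback.fst T.proj f ▷ G) = T.isPullback.lift (s.fst ≫ pullback.fst T.proj f)
          (s.snd ≫ pullback.fst T.proj f) (by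
            rw [Category.assoc, Category.assoc, pullback.condition, reassoc_of% s.condition]) := by
          apply T.isPullback.hom_ext
          · rw [T.isPullback.lift_fst, Category.assoc, whiskerRight_fst, reassoc_of% h₁]
          · rw [T.isPullback.lift_snd, ← h₂, Category.assoc, Category.assoc, pullback.lift_fst]
        rw [lift_snd, ← this, Category.assoc, whiskerRight_snd]

lemma equivariant_lift {X X' Y : Over S} (T : Torsor G X) (f : X' ⟶ X) (U : Torsor G Y)
    (h : U.P ⟶ T.P) (ha : U.act ≫ h = (h ▷ G) ≫ T.act) (q : Y ⟶ X')
    (hc : h ≫ T.proj = (U.proj ≫ q) ≫ f) :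
    U.act ≫ pullback.lift h (U.proj ≫ q) hc =
      (pullback.lift h (U.proj ≫ q) hc ▷ G) ≫ (T.baseChange f).act := by
  dsimp only [baseChange]
  apply pullback.hom_ext
  · rw [Category.assoc, Category.assoc, pullback.lift_fst, pullback.lift_fst,
      ← comp_whiskerRight_assoc, pullback.lift_fst, ha]
  · rw [Category.assoc, Category.assoc, pullback.lift_snd, pullback.lift_snd,
      whiskerRight_fst_assoc, pullback.lift_snd, reassoc_of% U.act_proj]

/-- A `G`-equivariant morphism of torsors over the same base is an isomorphism. -/
lemma isIso_of_equivariant {X : Over S} (T U : Torsor G X) (h : T.P ⟶ U.P)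
    (hp : h ≫ U.proj = T.proj) (ha : T.act ≫ h = (h ▷ G) ≫ U.act) : IsIso h := by
  have s0 : IsPullback (h ▷ G) (fst T.P G) (fst U.P G) h := by
    refine ⟨⟨by simp⟩, ⟨PullbackCone.IsLimit.mk _
      (fun s => lift s.snd (s.fst ≫ snd _ _)) ?_ ?_ ?_⟩⟩
    · intro s
      apply CartesianMonoidalCategory.hom_ext <;> simp [s.condition]
    · intro s
      simp
    · intro s m h₁ h₂
      apply CartesianMonoidalCategory.hom_ext
      · simpa using h₂
      · rw [lift_snd, ← h₁, Category.assoc, whiskerRight_snd]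
  have s2 : IsPullback (T.act ≫ h) (fst T.P G) U.proj T.proj := by
    have := s0.paste_horiz U.isPullback.flip
    rwa [← ha, hp] at this
  have s1 : IsPullback T.act (𝟙 _ ≫ fst T.P G) (h ≫ U.proj) T.proj := by
    rw [hp, Category.id_comp]; exact T.isPullback.flip
  have s3 : IsPullback T.act (𝟙 _) h (T.act ≫ h) :=
    IsPullback.of_bot s1 (by simp) s2
  have s3' := s3.map (Over.forget S)
  have s2' := s2.map (Over.forget S)
  have cov : (@Surjective ⊓ @Flat ⊓ @LocallyOfFinitePresentation : MorphismProperty Scheme.{u})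
      ((Over.forget S).map (T.act ≫ h)) :=
    ⟨⟨MorphismProperty.of_isPullback (P := @Surjective) s2'.flip T.surjective,
      MorphismProperty.of_isPullback (P := @Flat) s2'.flip T.flat⟩,
      MorphismProperty.of_isPullback (P := @LocallyOfFinitePresentation) s2'.flip
        T.locallyOfFinitePresentation⟩
  have : (MorphismProperty.isomorphisms Scheme.{u}) ((Over.forget S).map h) :=
    MorphismProperty.of_isPullback_of_descendsAlong
      (Q := @Surjective ⊓ @Flat ⊓ @LocallyOfFinitePresentation) s3'.flip cov
      (by simp only [MorphismProperty.isomorphisms.iff]; infer_instance)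
  rw [MorphismProperty.isomorphisms.iff] at this
  exact isIso_of_reflects_iso h (Over.forget S)

end Torsor

end Torsors

/-! ### The stack of formal torsors -/

section Delta

variable {k : Type u} [Field k]

/-- The map `A((t)) → B((t))` applying a homomorphism `A → B` to the coefficients. -/
def laurentMap {A B : Type u} [CommRing A] [CommRing B] (f : A →+* B) :
    LaurentSeries A →+* LaurentSeries B where
  toFun x := HahnSeries.map x f
  map_one' := HahnSeries.map_one f.toMonoidWithZeroHom
  map_mul' _ _ := HahnSeries.map_mul (f : A →ₙ+* B)
  map_zero' := by ext; simp
  map_add' _ _ := by ext; simp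

@[simp] lemma laurentMap_coeff {A B : Type u} [CommRing A] [CommRing B]
    (f : A →+* B) (x : LaurentSeries A) (n : ℤ) :
    (laurentMap f x).coeff n = f (x.coeff n) := rfl

/-- The structure map `k → B → B((t))` of the `k`-algebra `B((t))`. -/
def laurentStr (B : CommAlgCat.{u} k) : k →+* LaurentSeries B :=
  (HahnSeries.C : B →+* LaurentSeries B).comp (algebraMap k B)

lemma laurentMap_comp_laurentStr {A B : CommAlgCat.{u} k} (f : A ⟶ B) :
    (laurentMap f.hom.toRingHom).comp (laurentStr A) = laurentStr B := by
  ext1 c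
  change HahnSeries.map (HahnSeries.C (algebraMap k A c)) f.hom.toRingHom =
    HahnSeries.C (algebraMap k B c)
  rw [HahnSeries.map_C]
  exact congrArg _ (f.hom.commutes c)

variable (k) in
/-- The functor `Spec B ↦ Spec B((t))` from affine `k`-schemes to `k`-schemes. -/
def puncturedDisk : (CommAlgCat.{u} k)ᵒᵖ ⥤ Over (Spec (CommRingCat.of k)) where
  obj B := Over.mk (Spec.map (CommRingCat.ofHom (laurentStr B.unop)))
  map f := Over.homMk (Spec.map (CommRingCat.ofHom (laurentMap f.unop.hom.toRingHom)))
    ((Spec.map_comp _ _).symm.trans (congrArg (fun g => Spec.map (CommRingCat.ofHom g))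
      (laurentMap_comp_laurentStr f.unop)))
  map_id B := by
    ext1
    exact Spec.map_id (CommRingCat.of (LaurentSeries B.unop))
  map_comp f g := by
    ext1
    exact Spec.map_comp (CommRingCat.ofHom (laurentMap g.unop.hom.toRingHom))
      (CommRingCat.ofHom (laurentMap f.unop.hom.toRingHom))

/-- The objects of `Δ_G`: pairs of an affine `k`-scheme `Spec B` and a `G`-torsor over
`Spec B((t))`. -/
structure Delta (G : Over (Spec (CommRingCat.of k))) [GrpObj G] where
  /-- The affine `k`-scheme `Spec B`. -/
  base : (CommAlgCat.{u} k)ᵒᵖ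
  /-- The torsor over `Spec B((t))`. -/
  torsor : Torsor G ((puncturedDisk k).obj base)

namespace Delta

variable {G : Over (Spec (CommRingCat.of k))} [GrpObj G]

/-- A morphism of `Δ_G` over `Spec B ⟶ Spec B'`: a `G`-equivariant morphism of torsors
over `Spec B((t)) ⟶ Spec B'((t))`. -/
@[ext]
structure Hom (ξ η : Delta G) where
  /-- The morphism of affine `k`-schemes. -/
  base : ξ.base ⟶ η.base
  /-- The morphism of total spaces. -/
  top : ξ.torsor.P ⟶ η.torsor.P
  comm : top ≫ η.torsor.proj = ξ.torsor.proj ≫ (puncturedDisk k).map base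
  equivariant : ξ.torsor.act ≫ top = (top ▷ G) ≫ η.torsor.act

instance : Category (Delta G) where
  Hom := Hom
  id ξ := ⟨𝟙 _, 𝟙 _, by simp, by simp⟩
  comp φ ψ := ⟨φ.base ≫ ψ.base, φ.top ≫ ψ.top,
    by rw [Category.assoc, ψ.comm, reassoc_of% φ.comm, Functor.map_comp],
    by rw [reassoc_of% φ.equivariant, ψ.equivariant, comp_whiskerRight, Category.assoc]⟩
  id_comp _ := by apply Hom.ext <;> simp
  comp_id _ := by apply Hom.ext <;> simp
  assoc _ _ _ := by apply Hom.ext <;> simp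

@[ext] lemma hom_ext {ξ η : Delta G} {φ ψ : ξ ⟶ η} (h₁ : φ.base = ψ.base) (h₂ : φ.top = ψ.top) :
    φ = ψ := Hom.ext h₁ h₂

@[simp] lemma id_base (ξ : Delta G) : Hom.base (𝟙 ξ) = 𝟙 _ := rfl
@[simp] lemma id_top (ξ : Delta G) : Hom.top (𝟙 ξ) = 𝟙 _ := rfl
@[simp] lemma comp_base {ξ η ζ : Delta G} (φ : ξ ⟶ η) (ψ : η ⟶ ζ) :
    (φ ≫ ψ).base = φ.base ≫ ψ.base := rfl
@[simp] lemma comp_top {ξ η ζ : Delta G} (φ : ξ ⟶ η) (ψ : η ⟶ ζ) :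
    (φ ≫ ψ).top = φ.top ≫ ψ.top := rfl

variable (G) in
/-- The projection of `Δ_G` to `Aff/k`. -/
def toAff : Delta G ⥤ (CommAlgCat.{u} k)ᵒᵖ where
  obj ξ := ξ.base
  map φ := φ.base

end Delta

variable (p : ℕ) [Fact p.Prime] [CharP k p]

variable (k) in
/-- A `k`-algebra, for `k` a field of characteristic `p`, regarded as an `𝔽_p`-algebra. -/
def restrictFp : CommAlgCat.{u} k ⥤ CommAlgCat.{u} (ZMod p) where
  obj B := @CommAlgCat.of (ZMod p) _ B _ (Algebra.compHom B (ZMod.castHom (dvd_refl p) k))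
  map {A B} f :=
    letI := Algebra.compHom A (ZMod.castHom (dvd_refl p) k)
    letI := Algebra.compHom B (ZMod.castHom (dvd_refl p) k)
    CommAlgCat.ofHom ({ f.hom.toRingHom with
      commutes' := fun c => f.hom.commutes (ZMod.castHom (dvd_refl p) k c) } : A →ₐ[ZMod p] B)

variable (G : Over (Spec (CommRingCat.of k))) [GrpObj G]

/-- `Δ_G` as a category over `Aff/𝔽_p`, through `Aff/k ⟶ Aff/𝔽_p`: an object of `Δ_G` over an
`𝔽_p`-algebra `B` is a `k`-algebra structure on `B` with a `G`-torsor over `Spec B((t))`. -/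
def Delta.toAffFp : Delta G ⥤ AffFp.{u} p := Delta.toAff G ⋙ (restrictFp k p).op

namespace Delta

variable {G} {p}

lemma isHomLift_iff_of_src {R : Type u} [CommRing R] [Algebra k R] [alg : Algebra (ZMod p) R]
    (T : Torsor G ((puncturedDisk k).obj (op (CommAlgCat.of k R)))) {a : Delta G}
    (φ : Delta.mk (op (CommAlgCat.of k R)) T ⟶ a)
    (f : op (CommAlgCat.of (ZMod p) R) ⟶ (Delta.toAffFp p G).obj a) :
    (Delta.toAffFp p G).IsHomLift f φ ↔
      ∀ x : a.base.unop, f.unop.hom x = φ.base.unop.hom x := by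
  obtain rfl : alg = Algebra.compHom R (ZMod.castHom (dvd_refl p) k) := Subsingleton.elim _ _
  constructor
  · intro h x
    have := @IsHomLift.eq_of_isHomLift _ _ _ _ (Delta.toAffFp p G) _ _ f φ h
    rw [this]
    rfl
  · intro h
    obtain rfl : f = (Delta.toAffFp p G).map φ := by
      apply Quiver.Hom.unop_inj
      exact ConcreteCategory.hom_ext _ _ h
    exact Functor.IsHomLift.map φ

lemma isHomLift_iff_of_tgt {R : Type u} [CommRing R] [Algebra k R] [alg : Algebra (ZMod p) R]
    (T : Torsor G ((puncturedDisk k).obj (op (CommAlgCat.of k R)))) {c : Delta G}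
    (χ : c ⟶ Delta.mk (op (CommAlgCat.of k R)) T)
    (g : (Delta.toAffFp p G).obj c ⟶ op (CommAlgCat.of (ZMod p) R)) :
    (Delta.toAffFp p G).IsHomLift g χ ↔ ∀ x : R, g.unop.hom x = χ.base.unop.hom x := by
  obtain rfl : alg = Algebra.compHom R (ZMod.castHom (dvd_refl p) k) := Subsingleton.elim _ _
  constructor
  · intro h x
    have := @IsHomLift.eq_of_isHomLift _ _ _ _ (Delta.toAffFp p G) _ _ g χ h
    rw [this]
    rfl
  · intro h
    obtain rfl : g = (Delta.toAffFp p G).map χ := by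
      apply Quiver.Hom.unop_inj
      exact ConcreteCategory.hom_ext _ _ h
    exact Functor.IsHomLift.map χ

/-- Pullbacks in `Δ_G` over `Aff/𝔽_p`: the `k`-structure and the torsor are pulled back. -/
lemma exists_isStronglyCartesian (a : Delta G) (R : Type u) [CommRing R]
    [Algebra (ZMod p) R] (f : op (CommAlgCat.of (ZMod p) R) ⟶ (Delta.toAffFp p G).obj a) :
    ∃ (b : Delta G) (φ : b ⟶ a), (Delta.toAffFp p G).IsStronglyCartesian f φ := by
  let f₀ : a.base.unop →+* R := f.unop.hom.toRingHom
  let _ : Algebra k R := (f₀.comp (algebraMap k a.base.unop)).toAlgebra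
  let f₁ : a.base.unop ⟶ CommAlgCat.of k R :=
    CommAlgCat.ofHom ({ f₀ with commutes' := fun _ => rfl } : a.base.unop →ₐ[k] R)
  let T := a.torsor.baseChange ((puncturedDisk k).map f₁.op)
  let φ : Delta.mk (op (CommAlgCat.of k R)) T ⟶ a :=
    ⟨f₁.op, pullback.fst _ _, pullback.condition, (pullback.lift_fst _ _ _)⟩
  refine ⟨_, φ, ?_⟩
  have hφ : (Delta.toAffFp p G).IsHomLift f φ := (isHomLift_iff_of_src T φ f).2 fun _ => rfl
  refine ⟨fun {c} g φ' hφ' => ?_⟩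
  have e := IsHomLift.eq_of_isHomLift (p := Delta.toAffFp p G) (g ≫ f) φ'
  have e' (x : a.base.unop) : g.unop.hom (f₀ x) = φ'.base.unop.hom x :=
    congrArg (fun u => u.unop.hom x) e
  let g₁ : CommAlgCat.of k R ⟶ c.base.unop :=
    CommAlgCat.ofHom ({ (g.unop.hom.toRingHom : R →+* c.base.unop) with
      commutes' := fun x => (e' (algebraMap k _ x)).trans (φ'.base.unop.hom.commutes x) } :
        R →ₐ[k] c.base.unop)
  have hg₁ : φ'.base = g₁.op ≫ f₁.op := by
    apply Quiver.Hom.unop_inj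
    ext x
    exact (e' x).symm
  have hc : φ'.top ≫ a.torsor.proj =
      (c.torsor.proj ≫ (puncturedDisk k).map g₁.op) ≫ (puncturedDisk k).map f₁.op := by
    rw [φ'.comm, hg₁, Functor.map_comp, Category.assoc]
  let χ : c ⟶ Delta.mk (op (CommAlgCat.of k R)) T :=
    ⟨g₁.op, pullback.lift φ'.top (c.torsor.proj ≫ (puncturedDisk k).map g₁.op) hc,
      pullback.lift_snd _ _ _,
      a.torsor.equivariant_lift _ c.torsor φ'.top φ'.equivariant _ hc⟩
  refine ⟨χ, ⟨(isHomLift_iff_of_tgt T χ g).2 fun _ => rfl, ?_⟩, ?_⟩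
  · apply Delta.hom_ext
    · exact hg₁.symm
    · exact pullback.lift_fst _ _ _
  · rintro ψ ⟨hψ, rfl⟩
    have hb : ψ.base = g₁.op := by
      apply Quiver.Hom.unop_inj
      ext x
      exact ((isHomLift_iff_of_tgt T ψ g).1 hψ x).symm
    apply Delta.hom_ext
    · exact hb
    · apply pullback.hom_ext
      · exact (pullback.lift_fst _ _ _).symm
      · refine Eq.trans ?_ (pullback.lift_snd _ _ _).symm
        rw [← hb]
        exact ψ.comm

lemma isIso_base_of_isIso_map {a b : Delta G} (φ : a ⟶ b)
    (h : IsIso ((Delta.toAffFp p G).map φ)) : IsIso φ.base := by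
  have h₁ : IsIso ((forget (CommAlgCat (ZMod p))).map ((Delta.toAffFp p G).map φ).unop) :=
    inferInstance
  have h₂ : IsIso ((forget (CommAlgCat k)).map φ.base.unop) := h₁
  have h₃ : IsIso φ.base.unop := isIso_of_reflects_iso _ (forget (CommAlgCat k))
  exact (isIso_unop_iff φ.base).1 h₃

lemma isIso_of_isIso_base {a b : Delta G} (φ : a ⟶ b) (h : IsIso φ.base) : IsIso φ := by
  let f := (puncturedDisk k).map φ.base
  have hc : φ.top ≫ b.torsor.proj = (a.torsor.proj ≫ 𝟙 _) ≫ f := by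
    rw [Category.comp_id]; exact φ.comm
  have e₁ : IsIso (pullback.lift φ.top (a.torsor.proj ≫ 𝟙 _) hc) :=
    Torsor.isIso_of_equivariant a.torsor (b.torsor.baseChange f) _
      ((pullback.lift_snd _ _ _).trans (Category.comp_id _))
      (b.torsor.equivariant_lift f a.torsor φ.top φ.equivariant (𝟙 _) hc)
  have e₂ : IsIso φ.top := by
    rw [← pullback.lift_fst φ.top (a.torsor.proj ≫ 𝟙 _) hc]
    infer_instance
  refine ⟨⟨⟨inv φ.base, inv φ.top, ?_, ?_⟩, ?_, ?_⟩⟩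
  · rw [IsIso.inv_comp_eq, ← Category.assoc, φ.comm, Category.assoc, ← Functor.map_comp,
      IsIso.hom_inv_id, CategoryTheory.Functor.map_id, Category.comp_id]
  · rw [IsIso.comp_inv_eq, Category.assoc, φ.equivariant, ← comp_whiskerRight_assoc,
      IsIso.inv_hom_id, id_whiskerRight, Category.id_comp]
  · apply Delta.hom_ext <;> simp
  · apply Delta.hom_ext <;> simp

/-- `Δ_G` is a category fibered in groupoids. -/
instance : IsFiberedInGroupoids (Delta.toAffFp p G) where
  toIsFibered := .of_exists_isStronglyCartesian fun a R f => exists_isStronglyCartesian a R.unop f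
  isIso_of_fiber {S a b} φ hφ := by
    have h := IsHomLift.fac' (p := Delta.toAffFp p G) (𝟙 S) φ
    have h' : IsIso ((Delta.toAffFp p G).map φ) := by rw [h]; infer_instance
    exact isIso_of_isIso_base φ (isIso_base_of_isIso_map φ h')

end Delta

end Delta

end FormalTorsor

end

/-! The absolute Frobenius of `B((t))` is the composite of two commuting operations: Frobenius on
the coefficients, which is the base change defining the Frobenius of `Δ_G`, and `t ↦ t ^ p`
(`laurentExpand_laurentMap_powHom`, `laurentExpand_laurentMap`). Pullback along the coefficient
Frobenius is therefore invertible on torsors as soon as pullback along the absolute Frobenius is.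

For `G` étale over a perfect field, the absolute Frobenius of `G` is an isomorphism
(`isIso_frobOver_of_etale`). Transporting the action along it makes the Frobenius of a torsor `P`
over `X` an equivariant map over the Frobenius of `X`. Equivariant maps are Cartesian, so pulling
`P` back along the Frobenius of `X` returns `P` (`isPullback_frobOver`).

None of these Frobenius maps is `k`-linear; composing structure morphisms with the Frobenius of
`Spec k` or its inverse, an equivalence because `k` is perfect, repairs this. Likewise the Frobenius
of `Δ_G` changes the `k`-structure of the base, and perfectness undoes the change.

The argument is run on `IsFrobeniusLike` arrows, since a chosen pullback has its base only up to an
isomorphism. Faithfulness comes from `hom_ext_of_isFrobeniusLike`, fullness from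
`exists_comp_eq_of_isFrobeniusLike` and `exists_base_of_isFrobeniusLike`, essential surjectivity
from `exists_isFrobeniusLike`. -/

noncomputable section

namespace FormalTorsor

/-! ### The absolute Frobenius of a scheme in characteristic `p` -/

section AbsoluteFrobenius

variable {p : ℕ} [hp : Fact p.Prime]

/-- The Frobenius endomorphism of a ring in which `p = 0`. -/
def powHom {R : Type*} [CommRing R] (h : (p : R) = 0) : R →+* R where
  toFun x := x ^ p
  map_one' := one_pow p
  map_mul' x y := mul_pow x y p
  map_zero' := zero_pow hp.out.ne_zero
  map_add' x y := by
    obtain ⟨r, hr⟩ := exists_add_pow_prime_eq hp.out x y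
    rw [hr, h]
    ring

@[simp] lemma powHom_apply {R : Type*} [CommRing R] (h : (p : R) = 0) (x : R) :
    powHom h x = x ^ p := rfl

-- The condition `p = 0`, unlike `CharP`, passes to every open set, including the empty one, whose
-- ring of sections is zero.
omit hp in
lemma natCast_section_eq_zero {X : Scheme.{u}} (h : (p : Γ(X, ⊤)) = 0) (U : X.Opens) :
    (p : Γ(X, U)) = 0 := by
  have := congrArg (X.presheaf.map (homOfLE le_top : U ⟶ ⊤).op) h
  rwa [map_natCast, map_zero] at this

/-- The absolute Frobenius of a scheme in characteristic `p`. -/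
def frobScheme (X : Scheme.{u}) (h : (p : Γ(X, ⊤)) = 0) : X ⟶ X where
  base := 𝟙 _
  c :=
    { app U := CommRingCat.ofHom (powHom (natCast_section_eq_zero h U.unop))
      naturality U V f := by
        ext x
        exact (map_pow (X.presheaf.map f).hom x p).symm }
  prop x := by
    constructor
    intro a ha
    obtain ⟨U, hxU, s, rfl⟩ := X.presheaf.exists_germ_eq a
    rw [PresheafedSpace.stalkMap_germ_apply] at ha
    have h2 : IsUnit (X.presheaf.germ U x hxU (s ^ p)) := ha
    rw [map_pow] at h2
    exact (isUnit_pow_iff hp.out.ne_zero).1 h2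

lemma frobScheme_stalkMap {X : Scheme.{u}} (h : (p : Γ(X, ⊤)) = 0) (x : X)
    (a : X.presheaf.stalk x) :
    (frobScheme X h).stalkMap x a = a ^ p := by
  obtain ⟨U, hxU, s, rfl⟩ := X.presheaf.exists_germ_eq a
  refine ((frobScheme X h).germ_stalkMap_apply U x hxU s).trans ?_
  exact map_pow (X.presheaf.germ U x hxU).hom s p

lemma frobScheme_naturality {X Y : Scheme.{u}} (hX : (p : Γ(X, ⊤)) = 0) (hY : (p : Γ(Y, ⊤)) = 0)
    (f : X ⟶ Y) : frobScheme X hX ≫ f = f ≫ frobScheme Y hY := by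
  refine Scheme.Hom.ext rfl fun U ↦ ?_
  -- Both composites have the same base map, so the restriction map in the extensionality criterion
  -- is an identity.
  refine (congrArg (fun g ↦ (frobScheme X hX ≫ f).app U ≫ g) (X.presheaf.map_id _)).trans
    ((Category.comp_id _).trans ?_)
  ext s
  exact (map_pow (f.app U).hom s p).symm

lemma frobScheme_Spec (R : CommRingCat.{u}) (hR : (p : R) = 0) (h : (p : Γ(Spec R, ⊤)) = 0) :
    frobScheme (Spec R) h = Spec.map (CommRingCat.ofHom (powHom hR)) := by
  apply ext_of_isAffine
  rw [← cancel_epi (Scheme.ΓSpecIso R).inv, ← Scheme.ΓSpecIso_inv_naturality]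
  ext x
  exact (map_pow (Scheme.ΓSpecIso R).inv.hom x p).symm

/-- Germs, and equalities of germs, are represented on arbitrarily small affine neighbourhoods,
where the hypothesis applies. -/
lemma bijective_pow_stalk {X : Scheme.{u}}
    (H : ∀ U : X.Opens, IsAffineOpen U → Function.Bijective fun s : Γ(X, U) ↦ s ^ p)
    (h : (p : Γ(X, ⊤)) = 0) (x : X) :
    Function.Bijective fun s : X.presheaf.stalk x ↦ s ^ p := by
  have h0 : (p : X.presheaf.stalk x) = 0 := by
    simpa using congrArg (X.presheaf.germ ⊤ x trivial) h
  constructor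
  · refine (injective_iff_map_eq_zero (powHom h0)).2 fun a ha ↦ ?_
    obtain ⟨U, hxU, s, rfl⟩ := X.presheaf.exists_germ_eq a
    rw [powHom_apply, ← map_pow, ← map_zero (X.presheaf.germ U x hxU).hom] at ha
    obtain ⟨V, hxV, i, j, hij⟩ := X.presheaf.germ_eq x hxU hxU _ _ ha
    obtain ⟨W, hW, hxW, hWV : W ≤ V⟩ := exists_isAffineOpen_mem_and_subset hxV
    have h0 : X.presheaf.map (homOfLE hWV ≫ i).op s = 0 := by
      apply (H W hW).1
      have := congrArg (X.presheaf.map (homOfLE hWV).op) hij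
      simp only [map_pow, map_zero, zero_pow hp.out.ne_zero] at this ⊢
      simpa only [op_comp, Functor.map_comp, CommRingCat.comp_apply] using this
    rw [← X.presheaf.germ_res_apply (homOfLE hWV ≫ i) x hxW, h0, map_zero]
  · intro a
    obtain ⟨U, hxU, s, rfl⟩ := X.presheaf.exists_germ_eq a
    obtain ⟨W, hW, hxW, hWU : W ≤ U⟩ := exists_isAffineOpen_mem_and_subset hxU
    obtain ⟨t, ht⟩ := (H W hW).2 (X.presheaf.map (homOfLE hWU).op s)
    refine ⟨X.presheaf.germ W x hxW t, ?_⟩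
    simp only at ht ⊢
    rw [← X.presheaf.germ_res_apply (homOfLE hWU) x hxW, ← ht, map_pow]

lemma isIso_frobScheme {X : Scheme.{u}} (h : (p : Γ(X, ⊤)) = 0)
    (H : ∀ U : X.Opens, IsAffineOpen U → Function.Bijective fun s : Γ(X, U) ↦ s ^ p) :
    IsIso (frobScheme X h) := by
  rw [isIso_iff_isIso_stalkMap]
  refine ⟨inferInstanceAs (IsIso (𝟙 _)), fun x ↦ ?_⟩
  rw [ConcreteCategory.isIso_iff_bijective]
  have : ⇑((frobScheme X h).stalkMap x) = fun a : X.presheaf.stalk x ↦ a ^ p :=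
    funext fun a ↦ frobScheme_stalkMap h x a
  exact (congrArg Function.Bijective this).mpr (bijective_pow_stalk H h x)

end AbsoluteFrobenius

/-! ### Frobenius on étale algebras over a perfect field -/

section Etale

variable {p : ℕ} [hp : Fact p.Prime]

/-- An étale `k`-algebra is a finite product of finite separable extensions of `k`, and algebraic
extensions of a perfect field are perfect. -/
lemma bijective_pow_of_etale (k : Type u) [Field k] [CharP k p] [PerfectField k] (A : Type u)
    [CommRing A] [Algebra k A] [Algebra.Etale k A] : Function.Bijective fun s : A ↦ s ^ p := by
  obtain ⟨I, _, L, _, _, e, hL⟩ := (Algebra.Etale.iff_exists_algEquiv_prod k A).1 inferInstance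
  have hbij : ∀ i, Function.Bijective fun x : L i ↦ x ^ p := fun i ↦ by
    have := (hL i).1
    have : PerfectField (L i) := Algebra.IsAlgebraic.perfectField (K := k)
    have : CharP (L i) p := charP_of_injective_algebraMap (algebraMap k (L i)).injective p
    exact PerfectRing.bijective_frobenius (R := L i) (p := p)
  have : Function.Bijective fun x : Π i, L i ↦ x ^ p := Function.Bijective.piMap hbij
  have h2 : (fun s : A ↦ s ^ p) = e.symm ∘ (fun x : Π i, L i ↦ x ^ p) ∘ e := by
    ext s
    simp
  rw [h2]
  exact e.symm.bijective.comp (this.comp e.bijective)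

end Etale

/-! ### Twisting torsors along an automorphism of the base -/

section Twist

variable {S : Scheme.{u}} {G : Over S}

/-- For an endofunctor `E` of `S`-schemes and a morphism `E G ⟶ G`, the comparison
`E (P × G) ⟶ E P × G`. -/
def twistTensor (E : Over S ⥤ Over S) (γ : E.obj G ⟶ G) (P : Over S) :
    E.obj (P ⊗ G) ⟶ E.obj P ⊗ G :=
  lift (E.map (fst P G)) (E.map (snd P G) ≫ γ)

variable (E : Over S ⥤ Over S) (γ : E.obj G ⟶ G)

@[simp]
lemma twistTensor_fst (P : Over S) : twistTensor E γ P ≫ fst _ _ = E.map (fst P G) :=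
  lift_fst _ _

@[simp]
lemma twistTensor_fst_assoc (P : Over S) {Z : Over S} (h : E.obj P ⟶ Z) :
    twistTensor E γ P ≫ fst _ _ ≫ h = E.map (fst P G) ≫ h := by
  rw [← Category.assoc, twistTensor_fst]

@[simp]
lemma twistTensor_snd (P : Over S) : twistTensor E γ P ≫ snd _ _ = E.map (snd P G) ≫ γ :=
  lift_snd _ _

lemma twistTensor_naturality {P Q : Over S} (f : P ⟶ Q) :
    E.map (f ▷ G) ≫ twistTensor E γ Q = twistTensor E γ P ≫ (E.map f ▷ G) := by
  apply CartesianMonoidalCategory.hom_ext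
  · simp [← Functor.map_comp]
  · simp [← Functor.map_comp_assoc]

/-- An equivalence preserves products, so the comparison differs from an isomorphism only by `γ` on
the second factor. -/
instance [E.IsEquivalence] [IsIso γ] (P : Over S) : IsIso (twistTensor E γ P) := by
  have : twistTensor E γ P = CartesianMonoidalCategory.prodComparison E P G ≫ (E.obj P ◁ γ) := by
    apply CartesianMonoidalCategory.hom_ext <;> simp
  rw [this]
  infer_instance

variable [GrpObj G]

/-- Compatibility of `γ : E G ⟶ G` with the group structure of `G`. -/
structure IsGroupTwist : Prop where
  one : E.map (MonObj.one : 𝟙_ _ ⟶ G) ≫ γ = toUnit _ ≫ MonObj.one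
  mul : E.map (MonObj.mul : G ⊗ G ⟶ G) ≫ γ =
    lift (E.map (fst G G) ≫ γ) (E.map (snd G G) ≫ γ) ≫ MonObj.mul

variable {γ} {E}

/-- The torsor `E P` over `E X` obtained from a torsor `P` over `X`, where `E` is the change of
the structure morphism along an isomorphism. -/
def Torsor.twist {σ : S ⟶ S} [IsIso σ] {γ : (Over.map σ).obj G ⟶ G} [IsIso γ]
    (hγ : IsGroupTwist (Over.map σ) γ) {X : Over S} (T : Torsor G X) :
    Torsor G ((Over.map σ).obj X) where
  P := (Over.map σ).obj T.P
  proj := (Over.map σ).map T.proj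
  act := inv (twistTensor (Over.map σ) γ T.P) ≫ (Over.map σ).map T.act
  act_one := by
    -- The unit section is rewritten so as to end in `twistTensor`, which then cancels the inverse
    -- in the action.
    have : (Over.map σ).obj T.P ◁ (MonObj.one : 𝟙_ _ ⟶ G) =
        (ρ_ _).hom ≫ (Over.map σ).map ((ρ_ T.P).inv ≫ T.P ◁ MonObj.one) ≫
          twistTensor (Over.map σ) γ T.P := by
      apply CartesianMonoidalCategory.hom_ext
      · simp only [Category.assoc, twistTensor_fst, ← Functor.map_comp]
        simp [rightUnitor_hom]
      · simp only [Category.assoc, twistTensor_snd, ← Functor.map_comp_assoc]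
        simp only [whiskerLeft_snd, Category.assoc, Functor.map_comp, hγ.one]
        simp only [← Category.assoc]
        congr 1
        apply toUnit_unique
    rw [this]
    simp only [Category.assoc, IsIso.hom_inv_id_assoc, ← Functor.map_comp, T.act_one]
    simp
  act_mul := by
    -- After precomposition with the isomorphism `E ((P ⊗ G) ⊗ G) ≅ (E P ⊗ G) ⊗ G`, both sides of
    -- associativity become images under `E` of the two sides of `T.act_mul`.
    have h₁ : twistTensor (Over.map σ) γ (T.P ⊗ G) ≫ (twistTensor (Over.map σ) γ T.P ▷ G) ≫
        ((inv (twistTensor (Over.map σ) γ T.P) ≫ (Over.map σ).map T.act) ▷ G) =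
        (Over.map σ).map (T.act ▷ G) ≫ twistTensor (Over.map σ) γ T.P := by
      rw [← comp_whiskerRight, IsIso.hom_inv_id_assoc, twistTensor_naturality]
    have h₂ : twistTensor (Over.map σ) γ (T.P ⊗ G) ≫ (twistTensor (Over.map σ) γ T.P ▷ G) ≫
        (α_ _ G G).hom ≫ (Over.map σ).obj T.P ◁ MonObj.mul =
        (Over.map σ).map ((α_ T.P G G).hom ≫ T.P ◁ MonObj.mul) ≫
          twistTensor (Over.map σ) γ T.P := by
      apply CartesianMonoidalCategory.hom_ext
      · simp [← Functor.map_comp]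
      · simp only [Category.assoc, twistTensor_snd, Functor.map_comp, whiskerLeft_snd]
        simp only [← Functor.map_comp_assoc, whiskerLeft_snd]
        simp only [Functor.map_comp, Category.assoc, hγ.mul]
        simp only [← Category.assoc]
        congr 1
        apply CartesianMonoidalCategory.hom_ext
        · simp only [Category.assoc, associator_hom_snd_fst, whiskerRight_fst_assoc,
            twistTensor_fst_assoc, twistTensor_snd, lift_fst]
          simp only [← Functor.map_comp_assoc, associator_hom_snd_fst]
        · simp only [Category.assoc, associator_hom_snd_snd, whiskerRight_snd, twistTensor_snd, lift_snd]
          simp only [← Functor.map_comp_assoc, associator_hom_snd_snd]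
    rw [← cancel_epi (twistTensor (Over.map σ) γ T.P ▷ G),
      ← cancel_epi (twistTensor (Over.map σ) γ (T.P ⊗ G)), reassoc_of% h₁, reassoc_of% h₂,
      IsIso.hom_inv_id_assoc, ← Functor.map_comp, ← Functor.map_comp,
      T.act_mul, Category.assoc]
  -- `Over.map σ` leaves the underlying morphism of schemes unchanged.
  flat := T.flat
  locallyOfFinitePresentation := T.locallyOfFinitePresentation
  surjective := T.surjective
  isPullback := by
    refine IsPullback.of_iso (T.isPullback.map (Over.map σ))
      (asIso (twistTensor (Over.map σ) γ T.P)) (Iso.refl _) (Iso.refl _) (Iso.refl _) ?_ ?_ ?_ ?_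
    · simp
    · simp
    · simp
    · simp

/-- Equivariant morphisms of torsors are Cartesian. -/
lemma Torsor.isPullback_of_equivariant {X Y : Over S} (T : Torsor G X) (U : Torsor G Y)
    (h : T.P ⟶ U.P) (f : X ⟶ Y) (hp : h ≫ U.proj = T.proj ≫ f)
    (ha : T.act ≫ h = (h ▷ G) ≫ U.act) : IsPullback h T.proj U.proj f := by
  have hp' : h ≫ U.proj = (T.proj ≫ 𝟙 _) ≫ f := by rw [Category.comp_id, hp]
  have : IsIso (pullback.lift h (T.proj ≫ 𝟙 _) hp') :=
    Torsor.isIso_of_equivariant T (U.baseChange f) _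
      ((pullback.lift_snd _ _ _).trans (Category.comp_id _))
      (U.equivariant_lift f T h ha (𝟙 _) hp')
  exact IsPullback.of_iso_pullback ⟨hp⟩ (asIso (pullback.lift h (T.proj ≫ 𝟙 _) hp'))
    (pullback.lift_fst _ _ _) ((pullback.lift_snd _ _ _).trans (Category.comp_id _))

end Twist

/-! ### Frobenius twists of schemes over a perfect field -/

section FrobeniusTwist

variable (p : ℕ) [hp : Fact p.Prime] {k : Type u} [Field k] [CharP k p]

omit hp in
lemma natCast_over_eq_zero (X : Over (Spec (CommRingCat.of k))) : (p : Γ(X.left, ⊤)) = 0 := by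
  let f : k →+* Γ(X.left, ⊤) := ((Scheme.ΓSpecIso (.of k)).inv ≫ X.hom.appTop).hom
  rw [← map_natCast f, CharP.cast_eq_zero, map_zero]

variable (k) in
/-- The absolute Frobenius of `Spec k`. -/
def frobSpec : Spec (CommRingCat.of k) ⟶ Spec (CommRingCat.of k) :=
  Spec.map (CommRingCat.ofHom (powHom (CharP.cast_eq_zero k p)))

instance [PerfectField k] : IsIso (frobSpec p k) := by
  have : IsIso (CommRingCat.ofHom (powHom (CharP.cast_eq_zero k p))) := by
    rw [ConcreteCategory.isIso_iff_bijective]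
    exact PerfectRing.bijective_frobenius (R := k) (p := p)
  unfold frobSpec
  infer_instance

/-- The absolute Frobenius as a `k`-morphism, from a `k`-scheme with structure morphism composed with the Frobenius
of `k` to the scheme itself. -/
def frobOver (X : Over (Spec (CommRingCat.of k))) : (Over.map (frobSpec p k)).obj X ⟶ X :=
  Over.homMk (frobScheme X.left (natCast_over_eq_zero p X)) (by
    have h : (p : Γ(Spec (CommRingCat.of k), ⊤)) = 0 := natCast_over_eq_zero p (Over.mk (𝟙 _))
    refine (frobScheme_naturality _ h X.hom).trans ?_
    rw [frobScheme_Spec _ (CharP.cast_eq_zero k p)]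
    rfl)

lemma frobOver_naturality {X Y : Over (Spec (CommRingCat.of k))} (f : X ⟶ Y) :
    (Over.map (frobSpec p k)).map f ≫ frobOver p Y = frobOver p X ≫ f := by
  ext1
  exact (frobScheme_naturality (natCast_over_eq_zero p X) (natCast_over_eq_zero p Y) f.left).symm

lemma frobOver_naturality_assoc {X Y Z : Over (Spec (CommRingCat.of k))} (f : X ⟶ Y)
    (h : Y ⟶ Z) : (Over.map (frobSpec p k)).map f ≫ frobOver p Y ≫ h = frobOver p X ≫ f ≫ h := by
  rw [← Category.assoc, frobOver_naturality, Category.assoc]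

/-- This is the only use of étaleness; everything later needs just that the Frobenius of `G` is
invertible. -/
lemma isIso_frobOver_of_etale [PerfectField k] (G : Over (Spec (CommRingCat.of k)))
    [Etale G.hom] : IsIso (frobOver p G) := by
  have : IsIso ((Over.forget _).map (frobOver p G)) := by
    refine isIso_frobScheme (natCast_over_eq_zero p G) fun U hU ↦ ?_
    have h : (G.hom.appLE ⊤ U le_top).hom.Etale :=
      Etale.etale_appLE G.hom (isAffineOpen_top _) hU le_top
    let f : k →+* Γ(G.left, U) := ((Scheme.ΓSpecIso (.of k)).inv ≫ G.hom.appLE ⊤ U le_top).hom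
    have hf : f.Etale :=
      RingHom.Etale.respectsIso.2 _ (Scheme.ΓSpecIso (.of k)).symm.commRingCatIsoToRingEquiv h
    algebraize [f]
    exact bijective_pow_of_etale k _
  exact isIso_of_reflects_iso _ (Over.forget _)

variable {p} {G : Over (Spec (CommRingCat.of k))} [GrpObj G]

/-- Frobenius commutes with all morphisms, in particular with the unit and the multiplication. -/
lemma isGroupTwist_frobOver : IsGroupTwist (Over.map (frobSpec p k)) (frobOver p G) where
  one := by
    rw [frobOver_naturality]
    congr 1
    apply toUnit_unique
  mul := by
    rw [frobOver_naturality]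
    congr 1
    apply CartesianMonoidalCategory.hom_ext
    · simp [frobOver_naturality]
    · simp [frobOver_naturality]

omit [GrpObj G] in
lemma twistTensor_frobOver (P : Over (Spec (CommRingCat.of k))) :
    twistTensor (Over.map (frobSpec p k)) (frobOver p G) P ≫ (frobOver p P ▷ G) =
      frobOver p (P ⊗ G) := by
  apply CartesianMonoidalCategory.hom_ext
  · simp [frobOver_naturality]
  · simp [frobOver_naturality]

variable [PerfectField k] [IsIso (frobOver p G)]

/-- The Frobenius of `P` is equivariant from the twisted torsor to `P`, hence Cartesian: every
torsor is its own Frobenius pullback, up to the twist. -/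
lemma isPullback_frobOver {X : Over (Spec (CommRingCat.of k))} (T : Torsor G X) :
    IsPullback (frobOver p T.P) ((Over.map (frobSpec p k)).map T.proj) T.proj
      (frobOver p X) := by
  refine Torsor.isPullback_of_equivariant (T.twist isGroupTwist_frobOver) T _ _ ?_ ?_
  · exact (frobOver_naturality p T.proj).symm
  · change (inv (twistTensor (Over.map (frobSpec p k)) (frobOver p G) T.P) ≫
      (Over.map (frobSpec p k)).map T.act) ≫ frobOver p T.P = (frobOver p T.P ▷ G) ≫ T.act
    rw [Category.assoc, frobOver_naturality, IsIso.inv_comp_eq, ← Category.assoc,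
      twistTensor_frobOver]

/-- By naturality, precomposing with the Frobenius of `Z` amounts to postcomposing the twisted map
with the Frobenius of `P`, and the Cartesian square separates such maps. Equalities of maps into
torsors are later checked this way. -/
lemma Torsor.hom_ext_of_frobOver {X Z : Over (Spec (CommRingCat.of k))} (T : Torsor G X)
    {u v : Z ⟶ T.P} (h : u ≫ T.proj = v ≫ T.proj)
    (h' : frobOver p Z ≫ u = frobOver p Z ≫ v) : u = v := by
  apply (Over.map (frobSpec p k)).map_injective
  apply (isPullback_frobOver (p := p) T).hom_ext
  · rwa [frobOver_naturality, frobOver_naturality]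
  · rw [← Functor.map_comp, ← Functor.map_comp, h]

end FrobeniusTwist

/-! ### Inverse Frobenius twists of torsors -/

section InverseTwist

variable (p : ℕ) [hp : Fact p.Prime] {k : Type u} [Field k] [CharP k p] [PerfectField k]

/-- The absolute Frobenius of a `k`-scheme, as a morphism to the scheme with structure morphism
composed with the inverse of the Frobenius of `k`. -/
def frobOverInv (X : Over (Spec (CommRingCat.of k))) :
    X ⟶ (Over.map (inv (frobSpec p k))).obj X :=
  Over.homMk (frobScheme X.left (natCast_over_eq_zero p X)) (by
    have := Over.w (frobOver p X)
    change frobScheme X.left (natCast_over_eq_zero p X) ≫ X.hom ≫ inv (frobSpec p k) = X.hom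
    rw [← Category.assoc, IsIso.comp_inv_eq]
    exact this)

lemma frobOverInv_naturality {X Y : Over (Spec (CommRingCat.of k))} (f : X ⟶ Y) :
    f ≫ frobOverInv p Y = frobOverInv p X ≫ (Over.map (inv (frobSpec p k))).map f := by
  ext1
  exact (frobScheme_naturality (natCast_over_eq_zero p X) (natCast_over_eq_zero p Y) f.left).symm

lemma frobOverInv_naturality_assoc {X Y Z : Over (Spec (CommRingCat.of k))} (f : X ⟶ Y)
    (h : (Over.map (inv (frobSpec p k))).obj Y ⟶ Z) :
    f ≫ frobOverInv p Y ≫ h =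
      frobOverInv p X ≫ (Over.map (inv (frobSpec p k))).map f ≫ h := by
  rw [← Category.assoc, frobOverInv_naturality, Category.assoc]

instance isIso_frobOverInv (G : Over (Spec (CommRingCat.of k))) [IsIso (frobOver p G)] :
    IsIso (frobOverInv p G) := by
  have : IsIso ((Over.forget _).map (frobOverInv p G)) :=
    inferInstanceAs (IsIso ((Over.forget _).map (frobOver p G)))
  exact isIso_of_reflects_iso _ (Over.forget _)

variable {G : Over (Spec (CommRingCat.of k))} [GrpObj G] [IsIso (frobOver p G)]

lemma isGroupTwist_frobOverInv :
    IsGroupTwist (Over.map (inv (frobSpec p k))) (inv (frobOverInv p G)) where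
  one := by
    rw [IsIso.comp_inv_eq, Category.assoc, frobOverInv_naturality, ← Category.assoc]
    -- The twist is an equivalence, so it carries the unit object to a terminal object.
    have : toUnit _ ≫ frobOverInv p (𝟙_ (Over (Spec (CommRingCat.of k)))) = 𝟙 _ := by
      exact (isTerminalTensorUnit.isTerminalObj
        (Over.map (inv (frobSpec p k)))).hom_ext _ _
    rw [this, Category.id_comp]
  mul := by
    rw [IsIso.comp_inv_eq, Category.assoc, frobOverInv_naturality, ← Category.assoc,
      ← Category.id_comp ((Over.map (inv (frobSpec p k))).map MonObj.mul)]
    congr 1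
    rw [← cancel_mono (CartesianMonoidalCategory.prodComparison
      (Over.map (inv (frobSpec p k))) G G)]
    apply CartesianMonoidalCategory.hom_ext
    · simp [← frobOverInv_naturality]
    · simp [← frobOverInv_naturality]

omit [GrpObj G] in
lemma frobOverInv_twistTensor (P : Over (Spec (CommRingCat.of k))) :
    frobOverInv p (P ⊗ G) ≫
      twistTensor (Over.map (inv (frobSpec p k))) (inv (frobOverInv p G)) P =
      (frobOverInv p P ▷ G) := by
  apply CartesianMonoidalCategory.hom_ext
  · simp [← frobOverInv_naturality]
  · simp [← frobOverInv_naturality_assoc]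

variable {X : Over (Spec (CommRingCat.of k))} (T : Torsor G X)

/-- Makes the Frobenius of `P` a morphism of torsors out of `P` itself, as needed for essential
surjectivity. -/
lemma equivariant_frobOverInv :
    T.act ≫ frobOverInv p T.P =
      (frobOverInv p T.P ▷ G) ≫ (T.twist (isGroupTwist_frobOverInv p)).act := by
  change _ = (frobOverInv p T.P ▷ G) ≫
    inv (twistTensor (Over.map (inv (frobSpec p k))) (inv (frobOverInv p G)) T.P) ≫
      (Over.map (inv (frobSpec p k))).map T.act
  rw [← frobOverInv_twistTensor, Category.assoc, IsIso.hom_inv_id_assoc, frobOverInv_naturality]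

end InverseTwist

/-! ### The Frobenius of a ring of Laurent series -/

section Laurent

variable (p : ℕ) [hp : Fact p.Prime]

omit hp in
lemma natCast_laurentSeries_eq_zero {R : Type u} [CommRing R] (h : (p : R) = 0) :
    (p : LaurentSeries R) = 0 := by
  rw [← map_natCast (HahnSeries.C : R →+* LaurentSeries R), h, map_zero]

variable (R : Type u) [CommRing R]

/-- The endomorphism `t ↦ t ^ p` of `R((t))`. -/
def laurentExpand : LaurentSeries R →+* LaurentSeries R :=
  HahnSeries.embDomainRingHom (AddMonoidHom.mulLeft (p : ℤ))
    (mul_right_injective₀ (Nat.cast_ne_zero.2 hp.out.ne_zero))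
    (fun _ _ ↦ mul_le_mul_iff_right₀ (Nat.cast_pos.2 hp.out.pos))

variable {R}

lemma laurentExpand_coeff_mul (x : LaurentSeries R) (n : ℤ) :
    (laurentExpand p R x).coeff (p * n) = x.coeff n :=
  HahnSeries.embDomain_coeff (f := ⟨⟨AddMonoidHom.mulLeft (p : ℤ), _⟩, _⟩)

lemma laurentExpand_coeff_of_not_dvd (x : LaurentSeries R) {n : ℤ} (h : ¬ (p : ℤ) ∣ n) :
    (laurentExpand p R x).coeff n = 0 := by
  refine HahnSeries.embDomain_of_notMem_range ?_
  rintro ⟨m, rfl⟩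
  exact h ⟨m, rfl⟩

@[simp] lemma laurentExpand_C (r : R) :
    laurentExpand p R (HahnSeries.C r) = HahnSeries.C r :=
  HahnSeries.embDomainRingHom_C

/-- One map moves only exponents, the other only coefficients. This commutation makes `t ↦ t ^ p` an
inverse of the coefficient Frobenius on both sides, up to the absolute Frobenius. -/
lemma laurentExpand_laurentMap {A B : Type u} [CommRing A] [CommRing B] (f : A →+* B)
    (x : LaurentSeries A) :
    laurentExpand p B (laurentMap f x) = laurentMap f (laurentExpand p A x) := by
  ext n
  by_cases h : (p : ℤ) ∣ n
  · obtain ⟨m, rfl⟩ := h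
    simp [laurentExpand_coeff_mul]
  · simp [laurentExpand_coeff_of_not_dvd p _ h]

/-- The Frobenius of `R((t))` raises the coefficients and the variable to the power `p`. -/
lemma laurentExpand_laurentMap_powHom (h : (p : R) = 0) (x : LaurentSeries R) :
    laurentExpand p R (laurentMap (powHom h) x) = x ^ p := by
  -- The zero ring does not have characteristic `p`, so it is set aside.
  nontriviality R
  have : CharP R p := CharP.ringChar_of_prime_eq_zero hp.out h ▸ ringChar.charP R
  suffices H : (laurentExpand p R).comp (laurentMap (powHom h)) =
      powHom (natCast_laurentSeries_eq_zero p h) from congrArg (fun g ↦ g x) H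
  -- `R((t))` is the localization of `R[[t]]` at the powers of `t`, so power series suffice; for
  -- them the formula is `MvPowerSeries.map_frobenius_expand`.
  apply IsLocalization.ringHom_ext (Submonoid.powers (PowerSeries.X : PowerSeries R))
  ext f n
  have h1 : powHom (natCast_laurentSeries_eq_zero p h) (algebraMap _ _ f) =
      ((PowerSeries.map (_root_.frobenius R p) (f.expand p hp.out.ne_zero) : PowerSeries R) :
        LaurentSeries R) := by
    refine Eq.trans ?_ (congrArg _ (MvPowerSeries.map_frobenius_expand p hp.out.ne_zero).symm)
    exact (map_pow (HahnSeries.ofPowerSeries ℤ R) f p).symm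
  simp only [RingHom.comp_apply, h1]
  have h2 : algebraMap (PowerSeries R) (LaurentSeries R) f = (f : LaurentSeries R) := rfl
  rw [h2]
  have hp0 : (0 : ℤ) < p := Nat.cast_pos.2 hp.out.pos
  by_cases h : (p : ℤ) ∣ n
  · obtain ⟨m, rfl⟩ := h
    rw [laurentExpand_coeff_mul, laurentMap_coeff, PowerSeries.coeff_coe, PowerSeries.coeff_coe]
    have : (p : ℤ) * m < 0 ↔ m < 0 := by
      constructor <;> intro <;> nlinarith
    simp only [this, Int.natAbs_mul, Int.natAbs_natCast, PowerSeries.coeff_map,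
      PowerSeries.coeff_expand_mul]
    split_ifs <;> simp [hp.out.ne_zero, frobenius_def]
  · rw [laurentExpand_coeff_of_not_dvd p _ h, PowerSeries.coeff_coe, PowerSeries.coeff_map,
      PowerSeries.coeff_expand_of_not_dvd p hp.out.ne_zero _ (by rwa [← Int.natCast_dvd])]
    simp

end Laurent

/-! ### The Frobenius of `Δ_G` -/

section DiskSection

variable {p : ℕ} [hp : Fact p.Prime] {k : Type u} [Field k] [CharP k p]

omit hp in
variable (p) in
lemma natCast_algebra_eq_zero (A : CommAlgCat.{u} k) : (p : A) = 0 := by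
  rw [← map_natCast (algebraMap k A), CharP.cast_eq_zero, map_zero]

lemma frobOver_puncturedDisk_left (A : CommAlgCat.{u} k) :
    (frobOver p ((puncturedDisk k).obj (op A))).left =
      Spec.map (CommRingCat.ofHom (powHom (natCast_laurentSeries_eq_zero p
        (natCast_algebra_eq_zero p A)))) :=
  frobScheme_Spec (CommRingCat.of (LaurentSeries A))
    (natCast_laurentSeries_eq_zero p (natCast_algebra_eq_zero p A)) 
    (natCast_over_eq_zero p ((puncturedDisk k).obj (op A)))

variable {A A' : CommAlgCat.{u} k} (f : A ⟶ A') (j : A ≃+* A') (hf : ∀ x, f.hom x = j x ^ p)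

/-- For a homomorphism `f : A ⟶ A'` of `k`-algebras which is the Frobenius up to a ring
isomorphism `j : A ≃+* A'`, the morphism `Spec A((t)) ⟶ Spec A'((t))` given by `j⁻¹` and
`t ↦ t ^ p`. -/
def diskSection {A A' : CommAlgCat.{u} k} (f : A ⟶ A') (j : A ≃+* A')
    (hf : ∀ x, f.hom x = j x ^ p) : (Over.map (frobSpec p k)).obj ((puncturedDisk k).obj (op A)) ⟶
    (puncturedDisk k).obj (op A') :=
  Over.homMk (Spec.map (CommRingCat.ofHom
    ((laurentExpand p A).comp (laurentMap (j.symm : A' →+* A))))) (by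
    refine (Spec.map_comp _ _).symm.trans (Eq.trans ?_ (Spec.map_comp _ _))
    congr 1
    ext c : 2
    change laurentExpand p A (laurentMap (j.symm : A' →+* A) (HahnSeries.C (algebraMap k A' c))) =
      HahnSeries.C (algebraMap k A (c ^ p))
    rw [laurentExpand_laurentMap, laurentExpand_C]
    -- Since `f` is `k`-linear, `j` is only Frobenius-semilinear; this is why the source carries the
    -- twist by `frobSpec`.
    have h : algebraMap k A' c = j (algebraMap k A c ^ p) := by
      rw [map_pow, ← hf]
      exact (f.hom.commutes c).symm
    refine (HahnSeries.map_C _ (j.symm : A' →+* A)).trans ?_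
    rw [h, map_pow (algebraMap k A)]
    exact congrArg _ (j.symm_apply_apply _))

/-- With `map_comp_diskSection`, this inverts the map of disks induced by `f` on both sides, up to
the absolute Frobenius. -/
lemma diskSection_comp :
    diskSection f j hf ≫ (puncturedDisk k).map f.op = frobOver p _ := by
  ext1
  rw [frobOver_puncturedDisk_left]
  refine (Spec.map_comp _ _).symm.trans (congrArg Spec.map ?_)
  ext x : 2
  refine Eq.trans ?_ (laurentExpand_laurentMap_powHom p (natCast_algebra_eq_zero p A) x)
  refine congrArg (laurentExpand p A) ?_
  ext n
  change j.symm (f.hom (x.coeff n)) = x.coeff n ^ p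
  rw [hf, ← map_pow, j.symm_apply_apply]

lemma map_comp_diskSection :
    (Over.map (frobSpec p k)).map ((puncturedDisk k).map f.op) ≫ diskSection f j hf =
      frobOver p _ := by
  ext1
  rw [frobOver_puncturedDisk_left]
  refine (Spec.map_comp _ _).symm.trans (congrArg Spec.map ?_)
  ext x : 2
  refine Eq.trans ?_ (laurentExpand_laurentMap_powHom p (natCast_algebra_eq_zero p A') x)
  change laurentMap f.hom.toRingHom (laurentExpand p A (laurentMap (j.symm : A' →+* A) x)) = _
  rw [← laurentExpand_laurentMap]
  refine congrArg (laurentExpand p A') ?_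
  ext n
  change f.hom (j.symm (x.coeff n)) = x.coeff n ^ p
  rw [hf, j.apply_symm_apply]

variable (p) [PerfectField k]

/-- The `k`-algebra with the underlying ring of `B`, and structure map composed with the inverse of
the Frobenius of `k`. -/
def frobUntwist (B : CommAlgCat.{u} k) : CommAlgCat.{u} k :=
  @CommAlgCat.of k _ B _ ((algebraMap k B).comp
    (RingEquiv.ofBijective (powHom (CharP.cast_eq_zero k p))
      (PerfectRing.bijective_frobenius (R := k) (p := p))).symm.toRingHom).toAlgebra

/-- The identity, as a ring isomorphism. -/
def frobUntwistEquiv (B : CommAlgCat.{u} k) : frobUntwist p B ≃+* B :=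
  RingEquiv.refl B

lemma frobUntwistEquiv_algebraMap_pow (B : CommAlgCat.{u} k) (c : k) :
    frobUntwistEquiv p B (algebraMap k (frobUntwist p B) (c ^ p)) = algebraMap k B c :=
  congrArg (algebraMap k B) (RingEquiv.symm_apply_apply (RingEquiv.ofBijective
    (powHom (CharP.cast_eq_zero k p)) (PerfectRing.bijective_frobenius (R := k) (p := p))) c)

/-- The Frobenius of `B` as a homomorphism of `k`-algebras to `B`. -/
def frobUntwistHom (B : CommAlgCat.{u} k) : frobUntwist p B ⟶ B :=
  ConcreteCategory.ofHom (C := CommAlgCat k)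
    { (powHom (natCast_algebra_eq_zero p B)).comp (frobUntwistEquiv p B : frobUntwist p B →+* B) with
      commutes' := fun c ↦ by
        change (frobUntwistEquiv p B (algebraMap k (frobUntwist p B) c)) ^ p = algebraMap k B c
        rw [← map_pow, ← map_pow, frobUntwistEquiv_algebraMap_pow] }

lemma frobUntwistHom_apply (B : CommAlgCat.{u} k) (x : frobUntwist p B) :
    (frobUntwistHom p B).hom x = frobUntwistEquiv p B x ^ p := rfl

/-- The morphism of `k`-schemes given by `t ↦ t ^ p` on `B((t))`, from the disk of the untwisted
algebra to the untwisted disk. -/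
def untwistMap (B : CommAlgCat.{u} k) : (puncturedDisk k).obj (op (frobUntwist p B)) ⟶
    (Over.map (inv (frobSpec p k))).obj ((puncturedDisk k).obj (op B)) :=
  Over.homMk (Spec.map (CommRingCat.ofHom ((laurentMap
      ((frobUntwistEquiv p B).symm : B →+* frobUntwist p B)).comp (laurentExpand p B)))) (by
    refine (Category.assoc _ _ _).symm.trans ((IsIso.comp_inv_eq _).2 ?_)
    refine (Spec.map_comp _ _).symm.trans (Eq.trans (congrArg Spec.map ?_) (Spec.map_comp _ _))
    ext c : 2
    change laurentMap ((frobUntwistEquiv p B).symm : B →+* frobUntwist p B)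
      (laurentExpand p B (HahnSeries.C (algebraMap k B c))) =
      HahnSeries.C (algebraMap k (frobUntwist p B) (c ^ p))
    rw [laurentExpand_C, ← frobUntwistEquiv_algebraMap_pow p]
    refine (HahnSeries.map_C _ ((frobUntwistEquiv p B).symm : B →+* frobUntwist p B)).trans ?_
    exact congrArg _ ((frobUntwistEquiv p B).symm_apply_apply _))

/-- The same factorization of Frobenius, with the twist now on the target: a torsor over `B((t))` is
thereby a coefficient Frobenius pullback. -/
lemma map_comp_untwistMap (B : CommAlgCat.{u} k) :
    (puncturedDisk k).map (frobUntwistHom p B).op ≫ untwistMap p B = frobOverInv p _ := by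
  ext1
  refine Eq.trans ?_ (frobOver_puncturedDisk_left (p := p) B).symm
  refine (Spec.map_comp _ _).symm.trans (congrArg Spec.map ?_)
  ext x : 2
  refine Eq.trans ?_ (laurentExpand_laurentMap_powHom p (natCast_algebra_eq_zero p B) x)
  rw [laurentExpand_laurentMap]
  ext n
  change (frobUntwistHom p B).hom ((frobUntwistEquiv p B).symm ((laurentExpand p B x).coeff n)) =
    (laurentExpand p B x).coeff n ^ p
  rw [frobUntwistHom_apply, RingEquiv.apply_symm_apply]

end DiskSection

/-! ### Descent along arrows of `Δ_G` lying over Frobenius -/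

namespace Delta

variable {p : ℕ} [hp : Fact p.Prime] {k : Type u} [Field k] [CharP k p] [PerfectField k]
variable {G : Over (Spec (CommRingCat.of k))} [GrpObj G]

omit [PerfectField k] in
lemma isPullback {a b : Delta G} (θ : a ⟶ b) :
    IsPullback θ.top a.torsor.proj b.torsor.proj ((puncturedDisk k).map θ.base) :=
  Torsor.isPullback_of_equivariant _ _ _ _ θ.comm θ.equivariant

/-- A morphism of `Δ_G` lying over the absolute Frobenius, up to a ring isomorphism. -/
def IsFrobeniusLike (p : ℕ) {a' a : Delta G} (θ : a' ⟶ a) : Prop :=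
  ∃ j : a.base.unop ≃+* a'.base.unop, ∀ x, θ.base.unop.hom x = j x ^ p

variable [IsIso (frobOver p G)]

/-- The Frobenius of the total space of `a` factors through `θ`, so maps agreeing after `θ` agree
after Frobenius. -/
lemma hom_ext_of_isFrobeniusLike {a' a b : Delta G} {θ : a' ⟶ a} (hθ : IsFrobeniusLike p θ)
    {f g : a ⟶ b} (hb : f.base = g.base) (h : θ ≫ f = θ ≫ g) : f = g := by
  obtain ⟨j, hj⟩ := hθ
  apply Delta.hom_ext hb
  apply Torsor.hom_ext_of_frobOver (p := p) b.torsor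
  · rw [f.comm, g.comm, hb]
  · let l : (Over.map (frobSpec p k)).obj a.torsor.P ⟶ a'.torsor.P :=
      (isPullback θ).lift (frobOver p a.torsor.P)
        ((Over.map (frobSpec p k)).map a.torsor.proj ≫ diskSection θ.base.unop j hj) (by
          rw [Category.assoc]
          refine Eq.trans ?_ (congrArg _ (diskSection_comp θ.base.unop j hj).symm)
          exact (frobOver_naturality p a.torsor.proj).symm)
    have hl : l ≫ θ.top = frobOver p a.torsor.P := (isPullback θ).lift_fst _ _ _
    rw [← hl, Category.assoc, Category.assoc]
    exact congrArg (fun q ↦ l ≫ q) (congrArg Hom.top h)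

/-- If `l` lifts the Frobenius of `a` through `θ`, then `l ≫ u.top` must be Frobenius followed by
the map sought. The Cartesian Frobenius square of `b` recovers that map. -/
lemma exists_comp_eq_of_isFrobeniusLike {a' a b : Delta G} {θ : a' ⟶ a}
    (hθ : IsFrobeniusLike p θ) (u : a' ⟶ b) (f₀ : a.base ⟶ b.base)
    (hu : u.base = θ.base ≫ f₀) : ∃ f : a ⟶ b, f.base = f₀ ∧ θ ≫ f = u := by
  obtain ⟨j, hj⟩ := hθ
  obtain ⟨s, hs₁, hs₂⟩ : ∃ s : (Over.map (frobSpec p k)).obj ((puncturedDisk k).obj a.base) ⟶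
      (puncturedDisk k).obj a'.base, s ≫ (puncturedDisk k).map θ.base = frobOver p _ ∧
      (Over.map (frobSpec p k)).map ((puncturedDisk k).map θ.base) ≫ s = frobOver p _ :=
    ⟨diskSection θ.base.unop j hj, diskSection_comp θ.base.unop j hj,
      map_comp_diskSection θ.base.unop j hj⟩
  obtain ⟨l, hl₁, hl₂⟩ : ∃ l : (Over.map (frobSpec p k)).obj a.torsor.P ⟶ a'.torsor.P,
      l ≫ θ.top = frobOver p a.torsor.P ∧
      l ≫ a'.torsor.proj = (Over.map (frobSpec p k)).map a.torsor.proj ≫ s := by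
    have h : frobOver p a.torsor.P ≫ a.torsor.proj =
        ((Over.map (frobSpec p k)).map a.torsor.proj ≫ s) ≫ (puncturedDisk k).map θ.base := by
      rw [Category.assoc, hs₁, frobOver_naturality]
    exact ⟨(isPullback θ).lift _ _ h, (isPullback θ).lift_fst _ _ h, (isPullback θ).lift_snd _ _ h⟩
  -- The composite in the other order, needed to get `θ ≫ f = u`.
  have hl₃ : (Over.map (frobSpec p k)).map θ.top ≫ l = frobOver p a'.torsor.P := by
    apply (isPullback θ).hom_ext
    · rw [Category.assoc, hl₁, frobOver_naturality]
    · rw [Category.assoc, hl₂, ← Functor.map_comp_assoc, θ.comm, Functor.map_comp_assoc, hs₂,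
        frobOver_naturality]
  -- Semilinear equivariance of `l`: the factor `G` is acted on by its Frobenius. It yields
  -- equivariance of `f`.
  have hl₄ : (Over.map (frobSpec p k)).map a.torsor.act ≫ l =
      lift ((Over.map (frobSpec p k)).map (fst _ _) ≫ l)
        (frobOver p (a.torsor.P ⊗ G) ≫ snd _ _) ≫ a'.torsor.act := by
    apply (isPullback θ).hom_ext
    · rw [Category.assoc, hl₁, frobOver_naturality, Category.assoc, θ.equivariant]
      simp only [← Category.assoc]
      congr 1
      apply CartesianMonoidalCategory.hom_ext
      · simp [hl₁, frobOver_naturality]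
      · simp
    · rw [Category.assoc, Category.assoc, hl₂, a'.torsor.act_proj, lift_fst_assoc, Category.assoc,
        hl₂, ← Functor.map_comp_assoc, ← Functor.map_comp_assoc, a.torsor.act_proj]
  obtain ⟨f, hf₁, hf₂⟩ : ∃ f : a.torsor.P ⟶ b.torsor.P,
      f ≫ b.torsor.proj = a.torsor.proj ≫ (puncturedDisk k).map f₀ ∧
      frobOver p a.torsor.P ≫ f = l ≫ u.top := by
    have h : (l ≫ u.top) ≫ b.torsor.proj = (Over.map (frobSpec p k)).map
        (a.torsor.proj ≫ (puncturedDisk k).map f₀) ≫ frobOver p _ := by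
      rw [frobOver_naturality, Category.assoc, u.comm, hu, Functor.map_comp, reassoc_of% hl₂,
        reassoc_of% hs₁, frobOver_naturality_assoc]
    let w := (isPullback_frobOver (p := p) b.torsor).lift (l ≫ u.top)
      ((Over.map (frobSpec p k)).map (a.torsor.proj ≫ (puncturedDisk k).map f₀)) h
    -- The square produces a map between twists; full faithfulness of the twist removes it.
    refine ⟨(Over.map (frobSpec p k)).preimage w, ?_, ?_⟩
    · apply (Over.map (frobSpec p k)).map_injective
      rw [Functor.map_comp, Functor.map_preimage]
      exact (isPullback_frobOver b.torsor).lift_snd _ _ h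
    · rw [← frobOver_naturality, Functor.map_preimage]
      exact (isPullback_frobOver b.torsor).lift_fst _ _ h
  refine ⟨⟨f₀, f, hf₁, ?_⟩, rfl, Delta.hom_ext hu.symm ?_⟩
  · apply Torsor.hom_ext_of_frobOver (p := p) b.torsor
    · rw [Category.assoc, Category.assoc, hf₁, b.torsor.act_proj, whiskerRight_fst_assoc, hf₁,
        reassoc_of% a.torsor.act_proj]
    · rw [← frobOver_naturality_assoc, hf₂, reassoc_of% hl₄, u.equivariant]
      simp only [← Category.assoc]
      congr 1
      apply CartesianMonoidalCategory.hom_ext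
      · simp [← hf₂, frobOver_naturality_assoc]
      · simp
  · apply Torsor.hom_ext_of_frobOver (p := p) b.torsor
    · rw [comp_top, Category.assoc, hf₁, reassoc_of% θ.comm, u.comm, hu, Functor.map_comp]
    · rw [comp_top, ← frobOver_naturality_assoc, hf₂, reassoc_of% hl₃]

/-- Every object of `Δ_G` is the source of a morphism lying over the absolute Frobenius. -/
lemma exists_isFrobeniusLike (b : Delta G) :
    ∃ (a : Delta G) (θ : b ⟶ a), IsFrobeniusLike p θ := by
  let f := frobUntwistHom p b.base.unop
  -- The target carries the untwisted `k`-structure and the untwisted torsor, pulled back along `t ↦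
  -- t ^ p`; `θ` is the Frobenius of the total space.
  let T := b.torsor.twist (isGroupTwist_frobOverInv p)
  have hc : frobOverInv p b.torsor.P ≫ T.proj =
      (b.torsor.proj ≫ (puncturedDisk k).map f.op) ≫ untwistMap p _ := by
    rw [Category.assoc, map_comp_untwistMap]
    exact (frobOverInv_naturality p _).symm
  refine ⟨⟨op (frobUntwist p b.base.unop), T.baseChange (untwistMap p _)⟩, ⟨f.op, pullback.lift (frobOverInv p b.torsor.P)
    (b.torsor.proj ≫ (puncturedDisk k).map f.op) hc, pullback.lift_snd _ _ _,
    T.equivariant_lift (untwistMap p _) b.torsor _ (equivariant_frobOverInv p b.torsor) _ hc⟩,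
    frobUntwistEquiv p b.base.unop, frobUntwistHom_apply p b.base.unop⟩

end Delta

/-! ### Full faithfulness and essential surjectivity of Frobenius -/

namespace Delta

variable {p : ℕ} [hp : Fact p.Prime] {k : Type u} [Field k] [CharP k p]
variable {G : Over (Spec (CommRingCat.of k))} [GrpObj G]

lemma toAffFp_map_apply {a b : Delta G} (f : a ⟶ b) (x : b.base.unop) :
    ((Delta.toAffFp p G).map f).unop.hom x = f.base.unop.hom x := rfl

lemma base_eq_of_toAffFp_map_eq {a b : Delta G} {f g : a ⟶ b}
    (h : (Delta.toAffFp p G).map f = (Delta.toAffFp p G).map g) : f.base = g.base := by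
  apply Quiver.Hom.unop_inj
  ext x
  exact congrArg (fun u ↦ u.unop.hom x) h

lemma isFrobeniusLike_of_map_eq {a' a : Delta G} (θ : a' ⟶ a)
    (e : (Delta.toAffFp p G).obj a' ≅ (Delta.toAffFp p G).obj a)
    (h : (Delta.toAffFp p G).map θ = e.hom ≫ absFrob _) : IsFrobeniusLike p θ := by
  refine ⟨(CommAlgCat.algEquivOfIso e.unop).toRingEquiv, fun x ↦ ?_⟩
  rw [← toAffFp_map_apply (p := p), h]
  exact (congrArg e.hom.unop.hom (absFrob_apply _ _)).trans (map_pow e.hom.unop.hom x p)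

lemma IsFrobeniusLike.exists_map_eq {a' a : Delta G} {θ : a' ⟶ a} (h : IsFrobeniusLike p θ) :
    ∃ e : (Delta.toAffFp p G).obj a' ≅ (Delta.toAffFp p G).obj a,
      (Delta.toAffFp p G).map θ = e.hom ≫ absFrob _ := by
  obtain ⟨j, hj⟩ := h
  let i : ((Delta.toAffFp p G).obj a).unop ≃ₐ[ZMod p] ((Delta.toAffFp p G).obj a').unop :=
    -- Ring isomorphisms are automatically `𝔽_p`-linear.
    AlgEquiv.ofRingEquiv (f := j) fun c ↦ RingHom.congr_fun (RingHom.ext_zmod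
      ((j : a.base.unop →+* a'.base.unop).comp
        (algebraMap (ZMod p) ((Delta.toAffFp p G).obj a).unop))
      (algebraMap (ZMod p) ((Delta.toAffFp p G).obj a').unop)) c
  refine ⟨(CommAlgCat.isoMk i).op, ?_⟩
  apply Quiver.Hom.unop_inj
  ext x
  refine (hj x).trans ?_
  exact (map_pow j x p).symm.trans (congrArg j (absFrob_apply ((Delta.toAffFp p G).obj a) x).symm)

variable (p) in
/-- The isomorphism between the bases of an object and its Frobenius pullback. -/
def frobPullbackBaseIso (a : Delta G) :
    (Delta.toAffFp p G).obj (frobPullback (Delta.toAffFp p G) a) ≅ (Delta.toAffFp p G).obj a :=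
  eqToIso (Functor.IsPreFibered.pullbackObj_proj _ _)

lemma map_frobPullbackMap (a : Delta G) :
    (Delta.toAffFp p G).map (frobPullbackMap (Delta.toAffFp p G) a) =
      (frobPullbackBaseIso p a).hom ≫ absFrob _ := by
  have := IsHomLift.fac' (Delta.toAffFp p G) (absFrob ((Delta.toAffFp p G).obj a))
    (frobPullbackMap (Delta.toAffFp p G) a)
  rwa [eqToHom_refl, Category.comp_id] at this

lemma map_frobMap {a b : Delta G} (f : a ⟶ b) :
    (Delta.toAffFp p G).map (frobMap (Delta.toAffFp p G) f) =
      (frobPullbackBaseIso p a).hom ≫ (Delta.toAffFp p G).map f ≫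
        (frobPullbackBaseIso p b).inv :=
  IsHomLift.fac' (Delta.toAffFp p G) ((Delta.toAffFp p G).map f) _

lemma isFrobeniusLike_frobPullbackMap (a : Delta G) :
    IsFrobeniusLike p (frobPullbackMap (Delta.toAffFp p G) a) :=
  isFrobeniusLike_of_map_eq _ _ (map_frobPullbackMap a)

variable [PerfectField k]

/-- A morphism of affine `𝔽_p`-schemes between the bases of objects of `Δ_G` is a morphism of
`k`-schemes if it is so after composing with a Frobenius. -/
lemma exists_base_of_isFrobeniusLike {a' a b : Delta G} {θ : a' ⟶ a} (hθ : IsFrobeniusLike p θ)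
    (u : a' ⟶ b) (g : (Delta.toAffFp p G).obj a ⟶ (Delta.toAffFp p G).obj b)
    (h : (Delta.toAffFp p G).map u = (Delta.toAffFp p G).map θ ≫ g) :
    ∃ f₀ : a.base ⟶ b.base, u.base = θ.base ≫ f₀ ∧ ∀ x, f₀.unop.hom x = g.unop.hom x := by
  obtain ⟨j, hj⟩ := hθ
  let g' : b.base.unop →+* a.base.unop := g.unop.hom.toRingHom
  have hx (x : b.base.unop) : u.base.unop.hom x = θ.base.unop.hom (g' x) :=
    congrArg (fun v ↦ v.unop.hom x) h
  have hc (c : k) : g' (algebraMap k b.base.unop c) = algebraMap k a.base.unop c := by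
    -- The hypothesis compares only `p`-th powers, and the ring may be nonreduced, so they cannot be
    -- cancelled. Instead the scalar itself is taken to be a `p`-th power.
    obtain ⟨c, rfl⟩ := (PerfectRing.bijective_frobenius (R := k) (p := p)).2 c
    have h₁ := hx (algebraMap k b.base.unop c)
    have h₂ : u.base.unop.hom (algebraMap k b.base.unop c) =
        θ.base.unop.hom (algebraMap k a.base.unop c) :=
      (u.base.unop.hom.commutes c).trans (θ.base.unop.hom.commutes c).symm
    rw [h₂, hj, hj, ← map_pow j, ← map_pow j] at h₁
    simp only [map_pow, j.injective h₁]
  let f₁ : b.base.unop ⟶ a.base.unop := ConcreteCategory.ofHom (C := CommAlgCat k)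
    { g' with commutes' := hc }
  refine ⟨f₁.op, ?_, fun x ↦ rfl⟩
  apply Quiver.Hom.unop_inj
  ext x
  exact hx x

variable [IsIso (frobOver p G)]

instance : (frobenius (Delta.toAffFp p G)).Faithful where
  map_injective {a b f g} h := by
    replace h : frobMap (Delta.toAffFp p G) f = frobMap (Delta.toAffFp p G) g := h
    apply hom_ext_of_isFrobeniusLike (isFrobeniusLike_frobPullbackMap (p := p) a)
    · apply base_eq_of_toAffFp_map_eq (p := p)
      have := congrArg (Delta.toAffFp p G).map h
      rw [map_frobMap, map_frobMap] at this
      simpa using this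
    · rw [← frobMap_fac, ← frobMap_fac, h]

/-- The composite of `h` with the Cartesian arrow of `b` descends along that of `a`; `frobMap_uniq`
then identifies `h`. -/
lemma exists_frobMap_eq {a b : Delta G}
    (h : frobPullback (Delta.toAffFp p G) a ⟶ frobPullback (Delta.toAffFp p G) b) :
    ∃ f : a ⟶ b, frobMap (Delta.toAffFp p G) f = h := by
  let g : (Delta.toAffFp p G).obj a ⟶ (Delta.toAffFp p G).obj b :=
    (frobPullbackBaseIso p a).inv ≫ (Delta.toAffFp p G).map h ≫ (frobPullbackBaseIso p b).hom
  have hu : (Delta.toAffFp p G).map (h ≫ frobPullbackMap (Delta.toAffFp p G) b) =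
      (Delta.toAffFp p G).map (frobPullbackMap (Delta.toAffFp p G) a) ≫ g := by
    rw [Functor.map_comp, map_frobPullbackMap, map_frobPullbackMap, Category.assoc,
      absFrob_naturality]
    simp [g]
  obtain ⟨f₀, hf₀, hg⟩ := exists_base_of_isFrobeniusLike (isFrobeniusLike_frobPullbackMap a)
    _ g hu
  obtain ⟨f, hf, hfu⟩ := exists_comp_eq_of_isFrobeniusLike
    (isFrobeniusLike_frobPullbackMap (p := p) a) _ f₀ hf₀
  have hfg : (Delta.toAffFp p G).map f = g := by
    apply Quiver.Hom.unop_inj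
    ext x
    refine Eq.trans ?_ (hg x)
    rw [← hf]
    rfl
  have : (Delta.toAffFp p G).IsHomLift ((Delta.toAffFp p G).map f) h := by
    rw [hfg]
    have ha := Functor.IsPreFibered.pullbackObj_proj (p := Delta.toAffFp p G) (a := a) rfl
      (absFrob _)
    have hb := Functor.IsPreFibered.pullbackObj_proj (p := Delta.toAffFp p G) (a := b) rfl
      (absFrob _)
    refine IsHomLift.of_fac _ _ _ ha hb ?_
    rfl
  exact ⟨f, (frobMap_uniq (Delta.toAffFp p G) f h hfu.symm).symm⟩

instance : (frobenius (Delta.toAffFp p G)).Full where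
  map_surjective := exists_frobMap_eq

instance : (frobenius (Delta.toAffFp p G)).EssSurj where
  mem_essImage b := by
    obtain ⟨a, θ, hθ⟩ := exists_isFrobeniusLike (p := p) b
    obtain ⟨e, h⟩ := hθ.exists_map_eq
    -- Factoring `θ` through the Cartesian arrow gives a morphism over the isomorphism `e`, hence an
    -- isomorphism.
    let χ : b ⟶ frobPullback (Delta.toAffFp p G) a :=
      Functor.IsStronglyCartesian.map (Delta.toAffFp p G) (absFrob _)
        (frobPullbackMap (Delta.toAffFp p G) a) h θ
    have hχ : (Delta.toAffFp p G).IsHomLift e.hom χ :=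
      inferInstanceAs ((Delta.toAffFp p G).IsHomLift e.hom
        (Functor.IsStronglyCartesian.map (Delta.toAffFp p G) _ _ _ _))
    have h' : IsIso ((Delta.toAffFp p G).map χ) := by
      rw [IsHomLift.fac' (Delta.toAffFp p G) e.hom χ]
      infer_instance
    have : IsIso χ := isIso_of_isIso_base χ (isIso_base_of_isIso_map χ h')
    exact ⟨a, ⟨(asIso χ).symm⟩⟩

end Delta

end FormalTorsor

end

theorem mainTheorem7 (p : ℕ) [Fact p.Prime] (k : Type u) [Field k] [CharP k p] [PerfectField k]
    (G : Over (Spec (CommRingCat.of k))) [GrpObj G] [Etale G.hom] :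
    FormalTorsor.IsPerfect (FormalTorsor.Delta.toAffFp p G) := by
  have : IsIso (FormalTorsor.frobOver p G) := FormalTorsor.isIso_frobOver_of_etale p G
  exact { }
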